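/- Let $V$ be a finite set of $n$ nodes and let $p_{uv}\in[0,1]$ ($u,v\in V$) be edge probabilities of a directed graph on $V$, where $(u,v)$ is an edge iff $p_{uv}>0$. In the independent cascade (IC) model with seed set $S_0\subseteq V$ (and $S_{-1}=\emptyset$), at each time step $\tau\ge 1$ every node $u\in S_{\tau-1}\setminus S_{\tau-2}$ tries, independently over all pairs $(u,v)$, to activate each $v\notin S_{\tau-1}$, succeeding with probability $p_{uv}$; $S_\tau$ is $S_{\tau-1}$ together with the newly activated nodes. The sequence $(S_0,\dots,S_{n-1})$ is a cascade (the diffusion is over at time $n-1$, and $S_\tau=S_{n-1}$ for $\tau\ge n$), and $\sigma^p(S)=\mathbb E\,|S_{n-1}|$ for $S_0=S$ is the influence spread; write $\sigma=\sigma^p$. Let $\mathcal D$ be a product distribution on subsets of $V$ (each node is a seed independently of the others), $q_u=\Pr_{S_0\sim\mathcal D}[u\in S_0]$, and let $\mathrm{ap}(v)=\Pr[v\in S_1]$ when $S_0\sim\mathcal D$. Assume that for some $\alpha\in(0,1]$ and $\gamma\in(0,1/2]$ we have $\mathrm{ap}(v)\le 1-\alpha$ and $\gamma\le q_v\le 1-\gamma$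 for all $v\in V$. From $t$ independent cascades $(S_{i,0},\dots,S_{i,n-1})_{i=1}^t$ with $S_{i,0}\sim\mathcal D$, compute $$\hat q_u=\frac{|\{i: u\in S_{i,0}\}|}{t},\qquad \widehat{\mathrm{ap}}(v)=\frac{|\{i: v\in S_{i,1}\}|}{t},\qquad \widehat{\mathrm{ap}}(v\mid\bar u)=\frac{|\{i: u\notin S_{i,0},\ v\in S_{i,1}\}|}{|\{i: u\notin S_{i,0}\}|},$$ $$\hat p_{uv}=\frac{\widehat{\mathrm{ap}}(v)-\widehat{\mathrm{ap}}(v\mid\bar u)}{\hat q_u\,(1-\widehat{\mathrm{ap}}(v\mid\bar u))}\quad(u,v\in V),$$ where a quotient with denominator $0$ is read as $0$, and let $\hat G$ be the graph on $V$ whose edge probabilities are the $\hat p_{uv}$ truncated to $[0,1]$, i.e. $\min\{1,\max\{0,\hat p_{uv}\}\}$. Let $\kappa\in(0,1]$ and let $A$ be a $\kappa$-approximation algorithm for influence maximization: for all edge probabilities $p'$ on $V$ and every integer $1\le k\le n$ it returns a set $A(p',k)$ of at most $k$ nodes with $\sigma^{p'}(A(p',k))\ge\kappa\max_{|T|\le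 k}\sigma^{p'}(T)$. Theorem. Let $\varepsilon,\delta\in(0,1)$, let $k$ be an integer with $1\le k\le n$, and suppose that $$t\ \ge\ \frac{1024}{\varepsilon^2\alpha^2\gamma^3}\cdot\frac{n^6}{k^2}\,\ln\frac{12n}{\delta}.$$ Let $S^A=A(\hat G,k)$ and let $S^*$ maximize $\sigma$ over the sets of at most $k$ nodes. Then $$\Pr\big[\sigma(S^A)\ge(\kappa-\varepsilon)\,\sigma(S^*)\big]\ \ge\ 1-\delta .$$ -/

import Mathlib

open MeasureTheory ProbabilityTheory

noncomputable section

/-- The law of the random subset of `ι` that contains each `i` independently with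
probability `r i`. -/
def randomSubset {ι : Type*} [Fintype ι] [DecidableEq ι] (r : ι → unitInterval) :
    PMF (Finset ι) :=
  PMF.ofFintype
    (fun S => ∏ i, ENNReal.ofReal (if i ∈ S then (r i : ℝ) else 1 - (r i : ℝ)))
    (by
      have h : ∀ S : Finset ι,
          (∏ i, ENNReal.ofReal (if i ∈ S then (r i : ℝ) else 1 - (r i : ℝ))) =
            (∏ i ∈ S, ENNReal.ofReal (r i : ℝ)) *
              ∏ i ∈ Sᶜ, ENNReal.ofReal (1 - (r i : ℝ)) := by
        intro S
        rw [← Finset.prod_mul_prod_compl S]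
        congr 1
        · exact Finset.prod_congr rfl fun i hi => by rw [if_pos hi]
        · exact Finset.prod_congr rfl fun i hi => by rw [if_neg (Finset.mem_compl.mp hi)]
      simp_rw [h]
      rw [← Fintype.prod_add]
      refine Finset.prod_eq_one fun i _ => ?_
      rw [← ENNReal.ofReal_add (r i).2.1 (sub_nonneg.mpr (r i).2.2)]
      simp)

/-- A weighted directed graph on `V`, given by its edge probabilities `p u v ∈ [0, 1]`;
`(u, v)` is an edge if and only if `p u v > 0`. -/
abbrev EdgeProb (V : Type*) := V → V → unitInterval

section Diffusion

variable {V : Type*} [Fintype V] [DecidableEq V]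

/-- One step of the independent cascade model, from `S_{τ-2} = A` and `S_{τ-1} = B` to `S_τ`:
`attempts` is the set of pairs `(u, v)` for which an attempt of `u` to activate `v` succeeds
(independently, with probability `p u v`), and only the nodes `u` that are active in `B` but
not in `A` make attempts. -/
def icStep (p : EdgeProb V) (A B : Finset V) : PMF (Finset V) :=
  (randomSubset fun e : V × V => p e.1 e.2).map fun attempts =>
    B ∪ Finset.univ.filter fun v => ∃ u ∈ B \ A, (u, v) ∈ attempts

/-- The law of `(S_0, …, S_m)` in the independent cascade model with seed set `S_0`
(and `S_{-1} = ∅`). -/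
def icTrajectory (p : EdgeProb V) (S₀ : Finset V) :
    (m : ℕ) → PMF (Fin (m + 1) → Finset V)
  | 0 => PMF.pure fun _ => S₀
  | 1 => (icStep p ∅ S₀).map fun S₁ => ![S₀, S₁]
  | m + 2 => (icTrajectory p S₀ (m + 1)).bind fun c =>
      (icStep p (c (Fin.last m).castSucc) (c (Fin.last (m + 1)))).map fun S =>
        (Fin.snoc c S : Fin (m + 3) → Finset V)

variable (V) in
/-- The sequences `(S_0, …, S_{n-1})` of active sets, where `n = |V|`. -/
abbrev Cascade := Fin (Fintype.card V - 1 + 1) → Finset V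

/-- The active set `S_τ` of a cascade. The diffusion is over at time `n - 1`, so that
`S_τ = S_{n-1}` for later times (this is used only for `τ = 1` if `n = 1`). -/
def Cascade.active (c : Cascade V) (τ : ℕ) : Finset V :=
  c ⟨min τ (Fintype.card V - 1), Nat.lt_succ_of_le (min_le_right _ _)⟩

/-- The influence spread `σ(S) = E |Φ(S)|`, with `Φ(S) = S_{n-1}` for the seed set `S`. -/
def influenceSpread (p : EdgeProb V) (S : Finset V) : ℝ :=
  ∑ c : Cascade V, (icTrajectory p S (Fintype.card V - 1) c).toReal *
    ((c.active (Fintype.card V - 1)).card : ℝ)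

/-- The law of a cascade whose seed set has the distribution `D`. -/
def cascadeLaw (p : EdgeProb V) (D : PMF (Finset V)) : PMF (Cascade V) :=
  D.bind fun S₀ => icTrajectory p S₀ (Fintype.card V - 1)

/-- Each node is drawn as a seed independently of the others. -/
def IsProductSeedDistribution (D : PMF (Finset V)) : Prop :=
  ∃ r : V → unitInterval, D = randomSubset r

/-- `q_u`, the probability that `u` is a seed. -/
def seedProb (D : PMF (Finset V)) (u : V) : ℝ :=
  (D.toOuterMeasure {S | u ∈ S}).toReal

/-- `ap(v)`, the probability that `v` is active after one time step. -/
def activationProb (p : EdgeProb V) (D : PMF (Finset V)) (v : V) : ℝ :=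
  ((cascadeLaw p D).toOuterMeasure {c | v ∈ c.active 1}).toReal

/-- The one-step activation condition and the seed condition with parameters `α`, `γ`. -/
structure EstimationAssumption (p : EdgeProb V) (D : PMF (Finset V)) (α γ : ℝ) : Prop where
  alpha_mem : α ∈ Set.Ioc (0 : ℝ) 1
  gamma_mem : γ ∈ Set.Ioc (0 : ℝ) (1 / 2)
  activationProb_le : ∀ v, activationProb p D v ≤ 1 - α
  le_seedProb : ∀ u, γ ≤ seedProb D u
  seedProb_le : ∀ u, seedProb D u ≤ 1 - γ

end Diffusion

section Estimation

variable {V : Type*} [Fintype V] [DecidableEq V] {t : ℕ}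

/-- `q̂_u = t_u / t`. -/
def estSeedProb (c : Fin t → Cascade V) (u : V) : ℝ :=
  ((Finset.univ.filter fun i => u ∈ (c i).active 0).card : ℝ) / t

/-- The estimate `t^v / t` of `ap(v)`. -/
def estActivationProb (c : Fin t → Cascade V) (v : V) : ℝ :=
  ((Finset.univ.filter fun i => v ∈ (c i).active 1).card : ℝ) / t

/-- The estimate of `ap(v | ū)`: the fraction of the cascades with `v ∈ S_1` among those in
which `u` is not a seed. -/
def estCondActivationProb (c : Fin t → Cascade V) (u v : V) : ℝ :=
  ((Finset.univ.filter fun i => u ∉ (c i).active 0 ∧ v ∈ (c i).active 1).card : ℝ) /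
    ((Finset.univ.filter fun i => u ∉ (c i).active 0).card : ℝ)

/-- The estimate `p̂_{uv}` of the edge probability. -/
def estEdgeProb (c : Fin t → Cascade V) (u v : V) : ℝ :=
  (estActivationProb c v - estCondActivationProb c u v) /
    (estSeedProb c u * (1 - estCondActivationProb c u v))

/-- The learned graph: the estimates, truncated to `[0, 1]` so that they are probabilities. -/
def learnedGraph (c : Fin t → Cascade V) : EdgeProb V :=
  fun u v => Set.projIcc (0 : ℝ) 1 zero_le_one (estEdgeProb c u v)

end Estimation

section Maximization

variable {V : Type*} [Fintype V] [DecidableEq V]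

/-- `S` is an optimal solution of influence maximization with at most `k` seeds. -/
def IsOptimalSeedSet (p : EdgeProb V) (k : ℕ) (S : Finset V) : Prop :=
  S.card ≤ k ∧ ∀ T : Finset V, T.card ≤ k → influenceSpread p T ≤ influenceSpread p S

/-- `A` is a `κ`-approximation algorithm for influence maximization: for every graph on `V` and
every positive `k ≤ n` it outputs at most `k` seeds whose spread is at least `κ` times the
optimum. -/
def IsApproxAlgorithm (κ : ℝ) (A : EdgeProb V → ℕ → Finset V) : Prop :=
  ∀ (p : EdgeProb V) (k : ℕ), 1 ≤ k → k ≤ Fintype.card V →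
    (A p k).card ≤ k ∧
      ∀ T : Finset V, T.card ≤ k → κ * influenceSpread p T ≤ influenceSpread p (A p k)

/-- Influence maximization from samples: learn the graph from the cascades and run `A` on it. -/
def imsAlgorithm (A : EdgeProb V → ℕ → Finset V) {t : ℕ} (c : Fin t → Cascade V) (k : ℕ) :
    Finset V :=
  A (learnedGraph c) k

end Maximization

end

/-! The proof recovers every non-loop edge probability up to an error `η` and then uses that
influence spread is Lipschitz in these probabilities.

Recovery. Seeds are independent, and making `u` a seed multiplies the probability that `v ≠ u` stays
inactive in the first step by `1 - p u v` (`inactiveProb_insert`). Averaging over the seed set gives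
`edge_identity`, a relation between `p u v`, the seed probability `q` of `u`, the activation
probability `a` of `v`, and the probability `f` that `v` is active while `u` is no seed. Solved for
`p u v` it is the estimator's formula. The bounds by `α` and `γ` keep the denominator of order `αγ`,
so errors `s = ηαγ/16` in `q`, `a`, `f` cost at most `η` (`abs_edge_formula_sub_le`). Hoeffding's
inequality and a union bound over the `2n + n²` frequencies make all these errors at most `s` with
the required probability.

Spread. A node attempts only once, in the step after its activation. Replacing the probabilities
step by step therefore charges each edge once, at a price of at most `n` nodes, so spreads move by
at most `n³η` (`abs_expectedActive_sub_le`).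

Conclusion. With `η = εk/(2n³)` every spread is known within `εk/2`. Two such errors cost at most
`εk`, and the optimum is at least `k`, which turns this into the relative loss `ε`. -/

noncomputable section

/-! ### Expectations under finite probability mass functions. -/

section Expectation

variable {α β : Type*} [Fintype α] [Fintype β]

/-- The expectation of a real function under a probability mass function on a finite type. -/
def PMF.finExp (μ : PMF α) (f : α → ℝ) : ℝ := ∑ a, (μ a).toReal * f a

namespace PMF

theorem sum_toReal_eq_one (μ : PMF α) : ∑ a, (μ a).toReal = 1 := by
  rw [← ENNReal.toReal_sum fun a _ => μ.apply_ne_top a, ← tsum_fintype (L := .unconditional _),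
    μ.tsum_coe, ENNReal.toReal_one]

theorem finExp_const (μ : PMF α) (x : ℝ) : μ.finExp (fun _ => x) = x := by
  rw [finExp, ← Finset.sum_mul, μ.sum_toReal_eq_one, one_mul]

theorem finExp_mono (μ : PMF α) {f g : α → ℝ} (h : ∀ a, f a ≤ g a) :
    μ.finExp f ≤ μ.finExp g :=
  Finset.sum_le_sum fun a _ => mul_le_mul_of_nonneg_left (h a) ENNReal.toReal_nonneg

theorem finExp_mono_support (μ : PMF α) {f g : α → ℝ} (h : ∀ a ∈ μ.support, f a ≤ g a) :
    μ.finExp f ≤ μ.finExp g := by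
  refine Finset.sum_le_sum fun a _ => ?_
  by_cases ha : a ∈ μ.support
  · exact mul_le_mul_of_nonneg_left (h a ha) ENNReal.toReal_nonneg
  · rw [PMF.mem_support_iff, not_not] at ha
    simp [ha]

theorem finExp_sub (μ : PMF α) (f g : α → ℝ) :
    μ.finExp (fun a => f a - g a) = μ.finExp f - μ.finExp g := by
  simp only [finExp, mul_sub, Finset.sum_sub_distrib]

theorem finExp_const_mul (μ : PMF α) (x : ℝ) (f : α → ℝ) :
    μ.finExp (fun a => x * f a) = x * μ.finExp f := by
  simp only [finExp, Finset.mul_sum, mul_left_comm]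

theorem abs_finExp_le (μ : PMF α) {f : α → ℝ} {x : ℝ} (h : ∀ a ∈ μ.support, |f a| ≤ x) :
    |μ.finExp f| ≤ x := by
  rw [abs_le]
  constructor
  · simpa only [finExp_const] using
      μ.finExp_mono_support (f := fun _ => -x) fun a ha => (abs_le.mp (h a ha)).1
  · simpa only [finExp_const] using
      μ.finExp_mono_support (g := fun _ => x) fun a ha => (abs_le.mp (h a ha)).2

theorem finExp_pure [DecidableEq α] (a : α) (f : α → ℝ) : (PMF.pure a).finExp f = f a := by
  simp [finExp, PMF.pure_apply, apply_ite ENNReal.toReal]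

theorem finExp_bind (μ : PMF α) (k : α → PMF β) (f : β → ℝ) :
    (μ.bind k).finExp f = μ.finExp fun a => (k a).finExp f := by
  have h : ∀ b, ((μ.bind k) b).toReal = ∑ a, (μ a).toReal * (k a b).toReal := by
    intro b
    rw [PMF.bind_apply, tsum_fintype, ENNReal.toReal_sum]
    · simp only [ENNReal.toReal_mul]
    · exact fun a _ => ENNReal.mul_ne_top (μ.apply_ne_top a) ((k a).apply_ne_top b)
  simp only [finExp, h, Finset.sum_mul, Finset.mul_sum]
  rw [Finset.sum_comm]
  simp only [mul_assoc]

theorem finExp_map [DecidableEq β] (μ : PMF α) (φ : α → β) (f : β → ℝ) :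
    (μ.map φ).finExp f = μ.finExp fun a => f (φ a) := by
  rw [PMF.map, finExp_bind]
  simp only [Function.comp_apply, finExp_pure]

theorem toOuterMeasure_toReal (μ : PMF α) (P : α → Prop) [DecidablePred P] :
    (μ.toOuterMeasure {a | P a}).toReal = μ.finExp fun a => if P a then 1 else 0 := by
  rw [PMF.toOuterMeasure_apply_fintype, ENNReal.toReal_sum]
  · refine Finset.sum_congr rfl fun a _ => ?_
    by_cases h : P a <;> simp [Set.indicator, h]
  · intro a _
    by_cases h : P a <;> simp [Set.indicator, h, μ.apply_ne_top a]

end PMF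

end Expectation

/-! ### Lipschitz dependence of product measures on their parameters. -/

section RandomSubset

variable {ι : Type*} [Fintype ι] [DecidableEq ι]

/-- The probability that a random subset agrees with `S` at all elements other than `i`. -/
def weightAway (r : ι → unitInterval) (i : ι) (S : Finset ι) : ℝ :=
  ∏ j ∈ Finset.univ.erase i, if j ∈ S then (r j : ℝ) else 1 - (r j : ℝ)

theorem weightAway_nonneg (r : ι → unitInterval) (i : ι) (S : Finset ι) :
    0 ≤ weightAway r i S := by
  refine Finset.prod_nonneg fun j _ => ?_
  split_ifs
  · exact (r j).2.1
  · exact sub_nonneg.mpr (r j).2.2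

theorem weightAway_insert (r : ι → unitInterval) (i : ι) (S : Finset ι) :
    weightAway r i (insert i S) = weightAway r i S := by
  refine Finset.prod_congr rfl fun j hj => ?_
  simp [Finset.ne_of_mem_erase hj]

theorem weightAway_congr {r r' : ι → unitInterval} {i : ι} (h : ∀ j, j ≠ i → r j = r' j)
    (S : Finset ι) : weightAway r i S = weightAway r' i S := by
  refine Finset.prod_congr rfl fun j hj => ?_
  rw [h j (Finset.ne_of_mem_erase hj)]

theorem randomSubset_toReal (r : ι → unitInterval) (i : ι) (S : Finset ι) :
    (randomSubset r S).toReal =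
      (if i ∈ S then (r i : ℝ) else 1 - (r i : ℝ)) * weightAway r i S := by
  rw [randomSubset, PMF.ofFintype_apply, ENNReal.toReal_prod, weightAway,
    Finset.mul_prod_erase Finset.univ (fun j => if j ∈ S then (r j : ℝ) else 1 - (r j : ℝ))
      (Finset.mem_univ i)]
  refine Finset.prod_congr rfl fun j _ => ENNReal.toReal_ofReal ?_
  split_ifs
  · exact (r j).2.1
  · exact sub_nonneg.mpr (r j).2.2

/-- Conditioning on whether the random subset contains `i`. -/
theorem finExp_randomSubset (r : ι → unitInterval) (i : ι) (f : Finset ι → ℝ) :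
    (randomSubset r).finExp f = ∑ S ∈ (Finset.univ.erase i).powerset,
      weightAway r i S * ((1 - (r i : ℝ)) * f S + (r i : ℝ) * f (insert i S)) := by
  have hi : i ∉ Finset.univ.erase i := Finset.notMem_erase i _
  rw [PMF.finExp, ← Finset.powerset_univ, ← Finset.insert_erase (Finset.mem_univ i),
    Finset.sum_powerset_insert hi, ← Finset.sum_add_distrib, Finset.insert_erase (Finset.mem_univ i)]
  refine Finset.sum_congr rfl fun S hS => ?_
  have hiS : i ∉ S := fun h => hi (Finset.mem_powerset.mp hS h)
  rw [randomSubset_toReal r i, randomSubset_toReal r i, if_neg hiS,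
    if_pos (Finset.mem_insert_self i S), weightAway_insert]
  ring

theorem sum_weightAway (r : ι → unitInterval) (i : ι) :
    ∑ S ∈ (Finset.univ.erase i).powerset, weightAway r i S = 1 := by
  have h := finExp_randomSubset r i fun _ => 1
  rw [PMF.finExp_const] at h
  simpa using h.symm

/-- Changing the probability of a single element. -/
theorem abs_finExp_randomSubset_sub_le_of_eq_off {r r' : ι → unitInterval} {i : ι}
    (h : ∀ j, j ≠ i → r j = r' j) {f : Finset ι → ℝ} {M : ℝ}
    (hf : ∀ S, f S ∈ Set.Icc 0 M) :
    |(randomSubset r).finExp f - (randomSubset r').finExp f| ≤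
      M * |(r i : ℝ) - (r' i : ℝ)| := by
  have hw : ∀ S, weightAway r' i S = weightAway r i S := fun S => (weightAway_congr h S).symm
  rw [finExp_randomSubset r i, finExp_randomSubset r' i, ← Finset.sum_sub_distrib]
  calc _ ≤ ∑ S ∈ (Finset.univ.erase i).powerset,
          weightAway r i S * (M * |(r i : ℝ) - (r' i : ℝ)|) := by
        refine (Finset.abs_sum_le_sum_abs _ _).trans (Finset.sum_le_sum fun S _ => ?_)
        rw [hw, ← mul_sub, abs_mul, abs_of_nonneg (weightAway_nonneg r i S)]
        refine mul_le_mul_of_nonneg_left ?_ (weightAway_nonneg r i S)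
        -- Conditionally on the other elements the expectation is affine in `r i`, with slope a
        -- difference of two values of `f`.
        have : (1 - (r i : ℝ)) * f S + r i * f (insert i S) -
            ((1 - (r' i : ℝ)) * f S + r' i * f (insert i S)) =
            (f (insert i S) - f S) * ((r i : ℝ) - r' i) := by ring
        rw [this, abs_mul]
        refine mul_le_mul_of_nonneg_right ?_ (abs_nonneg _)
        rw [abs_le]
        constructor <;> linarith [(hf S).1, (hf S).2, (hf (insert i S)).1, (hf (insert i S)).2]
    _ = _ := by rw [← Finset.sum_mul, sum_weightAway, one_mul]

/-- Elements on which the function does not depend may have any probability. -/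
theorem finExp_randomSubset_eq_of_eq_off {r r' : ι → unitInterval} {i : ι}
    (h : ∀ j, j ≠ i → r j = r' j) {f : Finset ι → ℝ} (hf : ∀ S, f (insert i S) = f S) :
    (randomSubset r).finExp f = (randomSubset r').finExp f := by
  rw [finExp_randomSubset r i, finExp_randomSubset r' i]
  refine Finset.sum_congr rfl fun S _ => ?_
  rw [hf, weightAway_congr h]
  ring

/-- The expectation of a function of a random subset is Lipschitz in the probabilities of the
elements on which the function depends. -/
theorem abs_finExp_randomSubset_sub_le (r r' : ι → unitInterval) (E : Finset ι)
    {f : Finset ι → ℝ} {M : ℝ} (hf : ∀ S, f S ∈ Set.Icc 0 M)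
    (hE : ∀ i ∉ E, ∀ S, f (insert i S) = f S) :
    |(randomSubset r).finExp f - (randomSubset r').finExp f| ≤
      M * ∑ i ∈ E, |(r i : ℝ) - (r' i : ℝ)| := by
  -- Hybrid argument: the probabilities on `F` are already switched to `r'`, and `F` grows by one
  -- element at a time.
  suffices h : ∀ F : Finset ι,
      |(randomSubset r).finExp f - (randomSubset (F.piecewise r' r)).finExp f| ≤
        M * ∑ i ∈ F ∩ E, |(r i : ℝ) - (r' i : ℝ)| by
    simpa [Finset.piecewise_univ] using h Finset.univ
  intro F
  induction F using Finset.induction_on with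
  | empty => simp
  | insert i F hi ih =>
    have hoff : ∀ j, j ≠ i → F.piecewise r' r j = (insert i F).piecewise r' r j := by
      intro j hj
      simp [Finset.piecewise, hj]
    by_cases hiE : i ∈ E
    · rw [Finset.insert_inter_of_mem hiE,
        Finset.sum_insert fun h => hi (Finset.mem_of_mem_inter_left h), mul_add, add_comm]
      refine (abs_sub_le _ ((randomSubset (F.piecewise r' r)).finExp f) _).trans
        (add_le_add ih ?_)
      simpa [hi] using abs_finExp_randomSubset_sub_le_of_eq_off hoff hf
    · rw [Finset.insert_inter_of_notMem hiE,
        ← finExp_randomSubset_eq_of_eq_off hoff (hE i hiE)]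
      exact ih

end RandomSubset

/-! ### Stability of the influence spread. -/

section Spread

variable {V : Type*} [Fintype V] [DecidableEq V]

/-- The set that results from `B` when the nodes of `B \ A` make the given attempts. -/
def spreadBy (A B : Finset V) (attempts : Finset (V × V)) : Finset V :=
  B ∪ Finset.univ.filter fun v => ∃ u ∈ B \ A, (u, v) ∈ attempts

theorem finExp_icStep (p : EdgeProb V) (A B : Finset V) (f : Finset V → ℝ) :
    (icStep p A B).finExp f =
      (randomSubset fun e : V × V => p e.1 e.2).finExp fun a => f (spreadBy A B a) :=
  PMF.finExp_map _ _ _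

theorem subset_of_mem_support_icStep {p : EdgeProb V} {A B S : Finset V}
    (h : S ∈ (icStep p A B).support) : B ⊆ S := by
  rw [icStep, PMF.support_map] at h
  obtain ⟨a, -, rfl⟩ := h
  exact Finset.subset_union_left

/-- The expected number of active nodes after `m` more steps from `S_{τ-1} = A`, `S_τ = B`. -/
def expectedActive (p : EdgeProb V) : ℕ → Finset V → Finset V → ℝ
  | 0, _, B => (B.card : ℝ)
  | m + 1, A, B => (icStep p A B).finExp fun S => expectedActive p m B S

theorem card_le_expectedActive (p : EdgeProb V) (m : ℕ) (A B : Finset V) :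
    (B.card : ℝ) ≤ expectedActive p m A B := by
  induction m generalizing A B with
  | zero => exact le_rfl
  | succ m ih =>
    rw [expectedActive, ← (icStep p A B).finExp_const (B.card : ℝ)]
    refine PMF.finExp_mono_support _ fun S hS => (Nat.cast_le.mpr ?_).trans (ih B S)
    exact Finset.card_le_card (subset_of_mem_support_icStep hS)

theorem expectedActive_le (p : EdgeProb V) (m : ℕ) (A B : Finset V) :
    expectedActive p m A B ≤ Fintype.card V := by
  induction m generalizing A B with
  | zero => exact Nat.cast_le.mpr (Finset.card_le_univ B)
  | succ m ih =>
    rw [expectedActive, ← (icStep p A B).finExp_const (Fintype.card V : ℝ)]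
    exact PMF.finExp_mono _ fun S => ih B S

/-- The last two sets form a Markov state. Keeping `j` future steps free lets the induction trade
the last step of the trajectory for one more step of the recursion, which runs from the front. -/
theorem finExp_icTrajectory_succ (p : EdgeProb V) (S₀ : Finset V) (j m : ℕ) :
    ((icTrajectory p S₀ (m + 1)).finExp fun c =>
      expectedActive p j (c (Fin.last m).castSucc) (c (Fin.last (m + 1)))) =
      expectedActive p (m + 1 + j) ∅ S₀ := by
  induction m generalizing j with
  | zero =>
    rw [icTrajectory, PMF.finExp_map, show 0 + 1 + j = j + 1 by omega, expectedActive]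
    rfl
  | succ m ih =>
    rw [icTrajectory, PMF.finExp_bind, show m + 1 + 1 + j = m + 1 + (j + 1) by omega, ← ih]
    congr 1
    ext c
    rw [PMF.finExp_map, expectedActive]
    simp only [Fin.snoc_last, Fin.snoc_castSucc]

theorem influenceSpread_eq_expectedActive (p : EdgeProb V) (S : Finset V) :
    influenceSpread p S = expectedActive p (Fintype.card V - 1) ∅ S := by
  have h : ∀ m, ((icTrajectory p S m).finExp fun c => ((c (Fin.last m)).card : ℝ)) =
      expectedActive p m ∅ S := by
    intro m
    cases m with
    | zero => rw [icTrajectory, PMF.finExp_pure]; rfl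
    | succ m => exact finExp_icTrajectory_succ p S 0 m
  rw [← h]
  refine Finset.sum_congr rfl fun c _ => ?_
  rw [Cascade.active]
  congr 4
  exact Fin.ext (min_self _)

/-- Identifies the coordinates on which a step depends: pairs from a newly active node to an
inactive one. In particular loops never matter. -/
theorem spreadBy_insert {A B : Finset V} {e : V × V}
    (h : e ∉ (B \ A) ×ˢ Bᶜ) (a : Finset (V × V)) :
    spreadBy A B (insert e a) = spreadBy A B a := by
  obtain ⟨u, v⟩ := e
  simp only [Finset.mem_product, Finset.mem_compl, not_and, not_not] at h
  ext w
  simp only [spreadBy, Finset.mem_union, Finset.mem_filter, Finset.mem_univ, true_and,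
    Finset.mem_insert, Prod.mk.injEq]
  constructor
  · rintro (hw | ⟨x, hx, (⟨rfl, rfl⟩ | hxa)⟩)
    · exact Or.inl hw
    · exact Or.inl (h hx)
    · exact Or.inr ⟨x, hx, hxa⟩
  · rintro (hw | ⟨x, hx, hxa⟩)
    · exact Or.inl hw
    · exact Or.inr ⟨x, hx, Or.inr hxa⟩

/-- Every node makes its attempts only once, so each edge contributes to the error only once. -/
theorem abs_expectedActive_sub_le (p p' : EdgeProb V) (m : ℕ) (A B : Finset V) (hAB : A ⊆ B) :
    |expectedActive p m A B - expectedActive p' m A B| ≤ Fintype.card V *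
      ∑ u ∈ Aᶜ, ∑ v ∈ Finset.univ.erase u, |(p u v : ℝ) - (p' u v : ℝ)| := by
  induction m generalizing A B with
  | zero =>
    rw [expectedActive, expectedActive, sub_self, abs_zero]
    exact mul_nonneg (Nat.cast_nonneg _)
      (Finset.sum_nonneg fun u _ => Finset.sum_nonneg fun v _ => abs_nonneg _)
  | succ m ih =>
    rw [expectedActive, expectedActive]
    -- The intermediate process uses `p` for the current step and `p'` afterwards. Later steps
    -- involve only sources in `Bᶜ`, the current one only sources in `B \ A`; these partition `Aᶜ`.
    refine (abs_sub_le _ ((icStep p A B).finExp fun S => expectedActive p' m B S) _).trans ?_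
    have h₁ : |(icStep p A B).finExp (fun S => expectedActive p m B S) -
        (icStep p A B).finExp fun S => expectedActive p' m B S| ≤ Fintype.card V *
          ∑ u ∈ Bᶜ, ∑ v ∈ Finset.univ.erase u, |(p u v : ℝ) - (p' u v : ℝ)| := by
      rw [← PMF.finExp_sub]
      exact PMF.abs_finExp_le _ fun S hS => ih B S (subset_of_mem_support_icStep hS)
    have h₂ : |(icStep p A B).finExp (fun S => expectedActive p' m B S) -
        (icStep p' A B).finExp fun S => expectedActive p' m B S| ≤ Fintype.card V *
          ∑ u ∈ B \ A, ∑ v ∈ Finset.univ.erase u, |(p u v : ℝ) - (p' u v : ℝ)| := by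
      rw [finExp_icStep, finExp_icStep]
      refine (abs_finExp_randomSubset_sub_le _ _ ((B \ A) ×ˢ Bᶜ) (M := Fintype.card V)
        (fun a => ⟨(Nat.cast_nonneg _).trans (card_le_expectedActive p' m _ _),
          expectedActive_le p' m _ _⟩)
        fun e he a => by rw [spreadBy_insert he]).trans ?_
      refine mul_le_mul_of_nonneg_left ?_ (Nat.cast_nonneg _)
      rw [Finset.sum_product]
      refine Finset.sum_le_sum fun u hu => Finset.sum_le_sum_of_subset_of_nonneg ?_
        fun _ _ _ => abs_nonneg _
      intro v hv
      refine Finset.mem_erase.mpr ⟨?_, Finset.mem_univ v⟩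
      rintro rfl
      exact Finset.mem_compl.mp hv (Finset.mem_sdiff.mp hu).1
    refine (add_le_add h₁ h₂).trans (le_of_eq ?_)
    have hdisj : Disjoint Bᶜ (B \ A) :=
      Finset.disjoint_left.mpr fun u hu hu' =>
        Finset.mem_compl.mp hu (Finset.mem_sdiff.mp hu').1
    have hunion : Aᶜ = Bᶜ ∪ (B \ A) := by
      ext u
      have := @hAB u
      simp only [Finset.mem_compl, Finset.mem_union, Finset.mem_sdiff]
      tauto
    rw [hunion, Finset.sum_union hdisj, mul_add]

theorem card_le_influenceSpread (p : EdgeProb V) (S : Finset V) :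
    (S.card : ℝ) ≤ influenceSpread p S := by
  rw [influenceSpread_eq_expectedActive]
  exact card_le_expectedActive p _ _ _

/-- If all probabilities of edges other than loops are within `η`, then all influence spreads are
within `n³ η`. -/
theorem abs_influenceSpread_sub_le {p p' : EdgeProb V} {η : ℝ} (hη : 0 ≤ η)
    (h : ∀ u v, u ≠ v → |(p u v : ℝ) - (p' u v : ℝ)| ≤ η) (S : Finset V) :
    |influenceSpread p S - influenceSpread p' S| ≤ (Fintype.card V : ℝ) ^ 3 * η := by
  rw [influenceSpread_eq_expectedActive, influenceSpread_eq_expectedActive]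
  refine (abs_expectedActive_sub_le p p' _ ∅ S (Finset.empty_subset S)).trans ?_
  have hin : ∀ u : V, ∑ v ∈ Finset.univ.erase u, |(p u v : ℝ) - (p' u v : ℝ)| ≤
      Fintype.card V * η := by
    intro u
    refine (Finset.sum_le_card_nsmul _ _ η fun v hv =>
      h u v (Finset.ne_of_mem_erase hv).symm).trans ?_
    rw [nsmul_eq_mul]
    exact mul_le_mul_of_nonneg_right (Nat.cast_le.mpr (Finset.card_le_univ _)) hη
  have hout := Finset.sum_le_card_nsmul (∅ᶜ : Finset V) _ _ fun u _ => hin u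
  rw [Finset.compl_empty, Finset.card_univ, nsmul_eq_mul] at hout
  rw [Finset.compl_empty]
  refine (mul_le_mul_of_nonneg_left hout (Nat.cast_nonneg _)).trans (le_of_eq ?_)
  ring

end Spread

/-! ### The first step of a cascade and the identity for an edge probability. -/

section OneStep

variable {V : Type*} [Fintype V] [DecidableEq V]

/-- Later steps append sets without altering the first two, so they integrate out. -/
theorem finExp_icTrajectory_one (p : EdgeProb V) (S₀ : Finset V) (m : ℕ)
    (F : Finset V → Finset V → ℝ) :
    ((icTrajectory p S₀ (m + 1)).finExp fun c => F (c 0) (c 1)) =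
      (icStep p ∅ S₀).finExp fun S => F S₀ S := by
  induction m with
  | zero =>
    rw [icTrajectory, PMF.finExp_map]
    rfl
  | succ m ih =>
    rw [icTrajectory, PMF.finExp_bind, ← ih]
    congr 1
    ext c
    rw [PMF.finExp_map, ← Fin.castSucc_zero, ← Fin.castSucc_one]
    simp only [Fin.snoc_castSucc, PMF.finExp_const]

theorem finExp_icTrajectory_min_one (p : EdgeProb V) (S₀ : Finset V) {N : ℕ} (hN : 1 ≤ N)
    (F : Finset V → Finset V → ℝ) :
    ((icTrajectory p S₀ N).finExp fun c =>
      F (c ⟨min 0 N, Nat.lt_succ_of_le (min_le_right _ _)⟩)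
        (c ⟨min 1 N, Nat.lt_succ_of_le (min_le_right _ _)⟩)) =
      (icStep p ∅ S₀).finExp fun S => F S₀ S := by
  obtain ⟨m, rfl⟩ := Nat.exists_eq_add_of_le' hN
  rw [← finExp_icTrajectory_one p S₀ m]
  congr 1

theorem finExp_cascadeLaw_one (p : EdgeProb V) (D : PMF (Finset V))
    (hV : 1 ≤ Fintype.card V - 1) (F : Finset V → Finset V → ℝ) :
    ((cascadeLaw p D).finExp fun c => F (c.active 0) (c.active 1)) =
      D.finExp fun S => (icStep p ∅ S).finExp fun T => F S T := by
  rw [cascadeLaw, PMF.finExp_bind]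
  congr 1
  ext S
  exact finExp_icTrajectory_min_one p S hV F

/-- The probability that `v` is not active after one step from the seed set `S`. -/
def inactiveProb (p : EdgeProb V) (v : V) (S : Finset V) : ℝ :=
  (icStep p ∅ S).finExp fun T => if v ∈ T then 0 else 1

/-- Condition on the attempt along `(u, v)`. If `u` is a seed, `v` can stay inactive only when this
attempt fails; if not, the attempt has no effect. All other attempts from `u` are irrelevant to `v`.
-/
theorem inactiveProb_insert (p : EdgeProb V) {u v : V} (huv : u ≠ v) {S : Finset V}
    (hu : u ∉ S) : inactiveProb p v (insert u S) = (1 - (p u v : ℝ)) * inactiveProb p v S := by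
  have hmem : ∀ (B : Finset V) (a : Finset (V × V)),
      v ∈ spreadBy ∅ B a ↔ v ∈ B ∨ ∃ w ∈ B, (w, v) ∈ a := by
    intro B a
    simp [spreadBy]
  simp only [inactiveProb, finExp_icStep, finExp_randomSubset _ (u, v), hmem]
  rw [Finset.mul_sum]
  refine Finset.sum_congr rfl fun a ha => ?_
  have hea : (u, v) ∉ a := fun h =>
    Finset.notMem_erase (u, v) Finset.univ (Finset.mem_powerset.mp ha h)
  have h₁ : (v ∈ insert u S ∨ ∃ w ∈ insert u S, (w, v) ∈ a) ↔
      (v ∈ S ∨ ∃ w ∈ S, (w, v) ∈ a) := by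
    simp [huv.symm, hea]
  have h₂ : v ∈ insert u S ∨ ∃ w ∈ insert u S, (w, v) ∈ insert (u, v) a :=
    Or.inr ⟨u, Finset.mem_insert_self _ _, Finset.mem_insert_self _ _⟩
  have h₃ : (v ∈ S ∨ ∃ w ∈ S, (w, v) ∈ insert (u, v) a) ↔
      (v ∈ S ∨ ∃ w ∈ S, (w, v) ∈ a) := by
    refine or_congr_right (exists_congr fun w => and_congr_right fun hw => ?_)
    have : w ≠ u := fun h => hu (h ▸ hw)
    simp [this]
  simp only [h₁, h₃, if_pos h₂]
  ring

/-- The factor of `u` in the probability that `v` stays inactive in the first step. -/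
theorem finExp_inactiveProb (p : EdgeProb V) (r : V → unitInterval) {u v : V} (huv : u ≠ v) :
    (randomSubset r).finExp (inactiveProb p v) * (1 - (r u : ℝ)) =
      (1 - (r u : ℝ) * (p u v : ℝ)) *
        (randomSubset r).finExp fun S => if u ∈ S then 0 else inactiveProb p v S := by
  rw [finExp_randomSubset r u, finExp_randomSubset r u, Finset.sum_mul, Finset.mul_sum]
  refine Finset.sum_congr rfl fun S hS => ?_
  have hu : u ∉ S := fun h => Finset.notMem_erase u Finset.univ (Finset.mem_powerset.mp hS h)
  rw [inactiveProb_insert p huv hu, if_neg hu, if_pos (Finset.mem_insert_self u S)]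
  ring

theorem seedProb_eq (D : PMF (Finset V)) (u : V) :
    seedProb D u = D.finExp fun S => if u ∈ S then 1 else 0 :=
  D.toOuterMeasure_toReal _

theorem activationProb_eq (p : EdgeProb V) (D : PMF (Finset V)) (v : V) :
    activationProb p D v = (cascadeLaw p D).finExp fun c => if v ∈ c.active 1 then 1 else 0 :=
  (cascadeLaw p D).toOuterMeasure_toReal _

theorem seedProb_randomSubset (r : V → unitInterval) (u : V) :
    seedProb (randomSubset r) u = r u := by
  rw [seedProb_eq, finExp_randomSubset r u]
  conv_rhs => rw [← one_mul (r u : ℝ), ← sum_weightAway r u, Finset.sum_mul]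
  refine Finset.sum_congr rfl fun S hS => ?_
  have hu : u ∉ S := fun h => Finset.notMem_erase u Finset.univ (Finset.mem_powerset.mp hS h)
  rw [if_neg hu, if_pos (Finset.mem_insert_self u S)]
  ring

theorem finExp_cascadeLaw_seed (p : EdgeProb V) (D : PMF (Finset V))
    (hV : 1 ≤ Fintype.card V - 1) (u : V) :
    ((cascadeLaw p D).finExp fun c => if u ∈ c.active 0 then 1 else 0) = seedProb D u := by
  rw [finExp_cascadeLaw_one p D hV fun S _ => if u ∈ S then 1 else 0, seedProb_eq]
  simp only [PMF.finExp_const]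

/-- The identity from which the edge probability `p u v` is recovered. -/
theorem edge_identity (p : EdgeProb V) {D : PMF (Finset V)} (hD : IsProductSeedDistribution D)
    {u v : V} (huv : u ≠ v) :
    (1 - activationProb p D v) * (1 - seedProb D u) =
      (1 - seedProb D u * (p u v : ℝ)) * (1 - seedProb D u -
        (cascadeLaw p D).finExp fun c =>
          if u ∉ c.active 0 ∧ v ∈ c.active 1 then 1 else 0) := by
  -- Two distinct nodes guarantee that cascades record time `1`, so `active 1` is not cut back to
  -- time `0`.
  have hV : 1 ≤ Fintype.card V - 1 := by
    have := Fintype.one_lt_card_iff.mpr ⟨u, v, huv⟩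
    omega
  obtain ⟨r, rfl⟩ := hD
  have h₁ : 1 - activationProb p (randomSubset r) v =
      (randomSubset r).finExp (inactiveProb p v) := by
    rw [activationProb_eq]
    nth_rewrite 1 [← (cascadeLaw p (randomSubset r)).finExp_const 1]
    rw [← PMF.finExp_sub,
      finExp_cascadeLaw_one p _ hV fun _ T => (1 : ℝ) - if v ∈ T then 1 else 0]
    congr 1
    ext S
    rw [inactiveProb]
    congr 1
    ext T
    split_ifs <;> simp
  -- This is the probability that `u` is no seed and `v` is inactive at time `1`.
  have h₂ : (1 - seedProb (randomSubset r) u - (cascadeLaw p (randomSubset r)).finExp fun c =>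
      if u ∉ c.active 0 ∧ v ∈ c.active 1 then 1 else 0) =
      (randomSubset r).finExp fun S => if u ∈ S then 0 else inactiveProb p v S := by
    rw [← finExp_cascadeLaw_seed p _ hV]
    nth_rewrite 1 [← (cascadeLaw p (randomSubset r)).finExp_const 1]
    rw [← PMF.finExp_sub, ← PMF.finExp_sub,
      finExp_cascadeLaw_one p _ hV fun S T =>
        ((1 : ℝ) - if u ∈ S then 1 else 0) - if u ∉ S ∧ v ∈ T then 1 else 0]
    congr 1
    ext S
    by_cases hu : u ∈ S
    · simp [hu, PMF.finExp_const]
    · simp only [if_neg hu, inactiveProb]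
      congr 1
      ext T
      by_cases hv : v ∈ T <;> simp [hu, hv]
  rw [h₁, h₂, seedProb_randomSubset]
  exact finExp_inactiveProb p r huv

end OneStep

/-! ### Stability of the edge estimator. -/

section Estimation

/-- Stability of the formula for the edge probability `p` in terms of the seed probability `q`,
the activation probability `a`, and the probability `f` that `v` is active while `u` is no seed. -/
theorem abs_edge_formula_sub_le {p q a f q' a' f' α γ η s : ℝ}
    (hp₀ : 0 ≤ p) (hp₁ : p ≤ 1) (hα₀ : 0 < α) (hα₁ : α ≤ 1) (hγ₀ : 0 < γ)
    (hγq : γ ≤ q) (hqγ : q ≤ 1 - γ) (ha₀ : 0 ≤ a) (ha : a ≤ 1 - α) (hf : 0 ≤ f)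
    (hid : (1 - a) * (1 - q) = (1 - q * p) * (1 - q - f))
    (hη₀ : 0 ≤ η) (hη₁ : η ≤ 1 / 2) (hs : s = η * α * γ / 16)
    (hq : |q' - q| ≤ s) (ha' : |a' - a| ≤ s) (hf' : |f' - f| ≤ s) :
    |(a' - f' / (1 - q')) / (q' * (1 - f' / (1 - q'))) - p| ≤ η := by
  have hαγ : 0 < α * γ := mul_pos hα₀ hγ₀
  have hs₀ : 0 ≤ s := (abs_nonneg _).trans hq
  have hsαγ : s ≤ α * γ / 32 := by rw [hs]; nlinarith
  obtain ⟨hq1, hq2⟩ := abs_le.mp hq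
  obtain ⟨ha1, ha2⟩ := abs_le.mp ha'
  obtain ⟨hf1, hf2⟩ := abs_le.mp hf'
  have hαγγ : α * γ ≤ γ := mul_le_of_le_one_left hγ₀.le hα₁
  have hqp : 0 ≤ q * p := mul_nonneg (hγ₀.le.trans hγq) hp₀
  have hqp1 : q * p ≤ 1 - γ := by nlinarith
  have hg₀ : 0 < 1 - q - f := by
    have : 0 < (1 - q * p) * (1 - q - f) := by
      rw [← hid]; exact mul_pos (by linarith) (by linarith)
    exact pos_of_mul_pos_right this (by linarith)
  -- By `hid` and `1 - q * p ≤ 1`, the quantity `1 - q - f` is at least `(1 - a) * (1 - q)`.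
  have hg : α * (1 - q) ≤ 1 - q - f := by nlinarith
  have hαq : α * γ ≤ α * (1 - q) := mul_le_mul_of_nonneg_left (by linarith) hα₀.le
  have hg' : 15 / 16 * (α * (1 - q)) ≤ 1 - q' - f' := by linarith
  have hq' : 31 / 32 * q ≤ q' := by linarith
  have hq'0 : 0 < q' := by linarith
  have hQ'0 : 0 < 1 - q' := by linarith
  have hg'0 : 0 < 1 - q' - f' := by linarith
  have hden : 2 / 5 * (α * γ) ≤ q' * (1 - q' - f') := by
    -- By concavity `q * (1 - q)` is at least its endpoint value `γ * (1 - γ)`, and `γ ≤ 1 / 2`.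
    have h1 : γ / 2 ≤ q * (1 - q) := by nlinarith
    have h2 : 31 / 32 * q * (15 / 16 * (α * (1 - q))) ≤ q' * (1 - q' - f') :=
      mul_le_mul hq' hg' (by linarith) hq'0.le
    have h3 : α * (γ / 2) ≤ α * (q * (1 - q)) := mul_le_mul_of_nonneg_left h1 hα₀.le
    linarith
  have hform : (a' - f' / (1 - q')) / (q' * (1 - f' / (1 - q'))) - p =
      ((1 - q' - f') * (1 - p * q') - (1 - a') * (1 - q')) / (q' * (1 - q' - f')) := by
    have h1 : 1 - f' / (1 - q') = (1 - q' - f') / (1 - q') := by field_simp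
    rw [h1]
    field_simp
    ring
  rw [hform, abs_div, abs_of_pos (mul_pos hq'0 hg'0), div_le_iff₀ (mul_pos hq'0 hg'0)]
  have hnum : |(1 - q' - f') * (1 - p * q') - (1 - a') * (1 - q')| ≤ 4 * s := by
    -- The numerator vanishes at the true values by `hid`. The three terms of its increment are at
    -- most `2s`, `s` and `s`.
    have hN : (1 - q' - f') * (1 - p * q') - (1 - a') * (1 - q') =
        -((q' - q) + (f' - f)) * (1 - p * q') + (a' - a) * (1 - q') +
          (q' - q) * ((1 - a) - (1 - q - f) * p) := by
      linear_combination -hid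
    have hpq' : 0 ≤ p * q' := mul_nonneg hp₀ hq'0.le
    have hpq'1 : p * q' ≤ 1 := by nlinarith
    have hgp : 0 ≤ (1 - q - f) * p := mul_nonneg hg₀.le hp₀
    have hgp1 : (1 - q - f) * p ≤ 1 := by nlinarith
    have e1 : |-((q' - q) + (f' - f)) * (1 - p * q')| ≤ (2 * s) * 1 := by
      rw [abs_mul, abs_neg]
      refine mul_le_mul ((abs_add_le _ _).trans (by linarith)) ?_ (abs_nonneg _) (by linarith)
      rw [abs_le]; constructor <;> linarith
    have e2 : |(a' - a) * (1 - q')| ≤ s * 1 := by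
      rw [abs_mul]
      refine mul_le_mul ha' ?_ (abs_nonneg _) hs₀
      rw [abs_le]; constructor <;> linarith
    have e3 : |(q' - q) * ((1 - a) - (1 - q - f) * p)| ≤ s * 1 := by
      rw [abs_mul]
      refine mul_le_mul hq ?_ (abs_nonneg _) hs₀
      rw [abs_le]; constructor <;> linarith
    rw [hN]
    refine (abs_add_le _ _).trans ((add_le_add_left (abs_add_le _ _) _).trans ?_)
    linarith
  -- Here `4s = ηαγ/4`, below `η` times the denominator bound `2αγ/5`.
  refine hnum.trans ?_
  have := mul_le_mul_of_nonneg_left hden hη₀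
  have : 0 ≤ η * (α * γ) := mul_nonneg hη₀ hαγ.le
  rw [hs]
  linarith

variable {V : Type*} [Fintype V] [DecidableEq V] {t : ℕ}

/-- The fraction of the samples with the property `P`. -/
def empiricalFreq {β : Type*} (P : β → Prop) [DecidablePred P] (c : Fin t → β) : ℝ :=
  ((Finset.univ.filter fun i => P (c i)).card : ℝ) / t

/-- Dividing both counts by `t` turns the frequency within a random subsample into a quotient of
averages over all `t` samples, to which Hoeffding's inequality applies. -/
theorem estCondActivationProb_eq (ht : 0 < t) (c : Fin t → Cascade V) (u v : V) :
    estCondActivationProb c u v =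
      empiricalFreq (fun c : Cascade V => u ∉ c.active 0 ∧ v ∈ c.active 1) c /
        (1 - estSeedProb c u) := by
  have ht' : (t : ℝ) ≠ 0 := Nat.cast_ne_zero.mpr ht.ne'
  have hcard : ((Finset.univ.filter fun i => u ∉ (c i).active 0).card : ℝ) / t =
      1 - estSeedProb c u := by
    have h := Finset.card_filter_add_card_filter_not (s := (Finset.univ : Finset (Fin t)))
      fun i => u ∈ (c i).active 0
    rw [Finset.card_univ, Fintype.card_fin] at h
    rw [estSeedProb, eq_sub_iff_add_eq, ← add_div, div_eq_one_iff_eq ht', add_comm]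
    exact_mod_cast h
  rw [estCondActivationProb, ← hcard, empiricalFreq, div_div_div_cancel_right₀ ht']

end Estimation

/-! ### Hoeffding's inequality and the union bound. -/

section Concentration

variable {Ω : Type*} [MeasurableSpace Ω] {μ : Measure Ω} [IsProbabilityMeasure μ]
  {β : Type*} [Fintype β] [MeasurableSpace β] [MeasurableSingletonClass β]
  {t : ℕ} {C : Fin t → Ω → β} {ν : PMF β}

/-- Hoeffding's inequality for independent samples from a finite distribution. -/
theorem measureReal_sum_sub_finExp_ge_le (hCm : ∀ i, Measurable (C i)) (hC : iIndepFun C μ)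
    (hlaw : ∀ i, μ.map (C i) = ν.toMeasure) {f : β → ℝ} {a : ℝ}
    (hf : ∀ b, f b ∈ Set.Icc a (a + 1)) {s : ℝ} (hs : 0 ≤ s) :
    μ.real {ω | s * t ≤ ∑ i, (f (C i ω) - ν.finExp f)} ≤ Real.exp (-(2 * s ^ 2 * t)) := by
  have hfm : Measurable f := measurable_of_finite f
  have hmean : ∀ i, ∫ ω, f (C i ω) ∂μ = ν.finExp f := by
    intro i
    rw [← integral_map (hCm i).aemeasurable hfm.aestronglyMeasurable, hlaw i, PMF.integral_eq_sum]
    simp only [smul_eq_mul, PMF.finExp]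
  -- An interval of length `1` gives the variance proxy `(1/2)² = 1/4`.
  have hsub : ∀ i ∈ (Finset.univ : Finset (Fin t)),
      HasSubgaussianMGF (fun ω => f (C i ω) - ν.finExp f) (1 / 4) μ := by
    intro i _
    have h := hasSubgaussianMGF_of_mem_Icc (μ := μ) (X := fun ω => f (C i ω))
      (hfm.comp (hCm i)).aemeasurable (Filter.Eventually.of_forall fun ω => hf (C i ω))
    rw [hmean i, add_sub_cancel_left, nnnorm_one] at h
    convert h using 1
    norm_num
  have hind : iIndepFun (fun i ω => f (C i ω) - ν.finExp f) μ :=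
    hC.comp (fun _ b => f b - ν.finExp f) fun _ => measurable_of_finite _
  refine (HasSubgaussianMGF.measure_sum_ge_le_of_iIndepFun hind hsub
    (mul_nonneg hs (Nat.cast_nonneg t))).trans (Real.exp_le_exp.mpr (le_of_eq ?_))
  rcases eq_or_ne (t : ℝ) 0 with h | h
  · simp [h]
  · simp only [Finset.sum_const, Finset.card_univ, Fintype.card_fin, nsmul_eq_mul]
    push_cast
    field_simp
    ring

theorem measureReal_empiricalFreq_sub_ge_le (ht : 0 < t) (hCm : ∀ i, Measurable (C i))
    (hC : iIndepFun C μ) (hlaw : ∀ i, μ.map (C i) = ν.toMeasure) (P : β → Prop)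
    [DecidablePred P] {s : ℝ} (hs : 0 ≤ s) :
    μ.real {ω | s ≤ |empiricalFreq P (fun i => C i ω) - ν.finExp fun b => if P b then 1 else 0|} ≤
      2 * Real.exp (-(2 * s ^ 2 * t)) := by
  have ht' : (0 : ℝ) < t := Nat.cast_pos.mpr ht
  set f : β → ℝ := fun b => if P b then 1 else 0 with hf
  have hsum : ∀ ω, ∑ i, (f (C i ω) - ν.finExp f) =
      (empiricalFreq P (fun i => C i ω) - ν.finExp f) * t := by
    intro ω
    rw [Finset.sum_sub_distrib, Finset.sum_const, Finset.card_univ, Fintype.card_fin, sub_mul,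
      empiricalFreq, div_mul_cancel₀ _ ht'.ne', nsmul_eq_mul, mul_comm, hf, Finset.sum_boole]
  have h₁ := measureReal_sum_sub_finExp_ge_le hCm hC hlaw (f := f) (a := 0)
    (fun b => by by_cases h : P b <;> simp [hf, h]) hs
  -- The lower tail is the upper tail of `-f`, with values in `[-1, 0]`.
  have h₂ := measureReal_sum_sub_finExp_ge_le hCm hC hlaw (f := fun b => -1 * f b) (a := -1)
    (fun b => by by_cases h : P b <;> simp [hf, h]) hs
  rw [two_mul]
  refine (measureReal_mono ?_).trans ((measureReal_union_le _ _).trans (add_le_add h₁ h₂))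
  intro ω hω
  rcases le_abs.mp (Set.mem_ofPred_eq ▸ hω : s ≤ |_|) with h | h
  · left
    rw [Set.mem_ofPred_eq, hsum]
    exact mul_le_mul_of_nonneg_right h ht'.le
  · right
    have : ∑ i, (-1 * f (C i ω) - ν.finExp fun b => -1 * f b) =
        -((empiricalFreq P (fun i => C i ω) - ν.finExp f) * t) := by
      rw [← hsum, ← Finset.sum_neg_distrib, PMF.finExp_const_mul]
      exact Finset.sum_congr rfl fun i _ => by ring
    rw [Set.mem_ofPred_eq, this, ← neg_mul]
    exact mul_le_mul_of_nonneg_right h ht'.le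

/-- A union bound over finitely many events for `empiricalFreq`. -/
theorem one_sub_le_measureReal_of_empiricalFreq (ht : 0 < t) (hCm : ∀ i, Measurable (C i))
    (hC : iIndepFun C μ) (hlaw : ∀ i, μ.map (C i) = ν.toMeasure) {J : Type*} [Fintype J]
    (P : J → β → Prop) [∀ j, DecidablePred (P j)] {s : ℝ} (hs : 0 ≤ s) {G : Set Ω}
    (hG : ∀ ω, (∀ j, |empiricalFreq (P j) (fun i => C i ω) -
      ν.finExp fun b => if P j b then 1 else 0| ≤ s) → ω ∈ G) :
    1 - Fintype.card J * (2 * Real.exp (-(2 * s ^ 2 * t))) ≤ μ.real G := by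
  set B : J → Set Ω := fun j => {ω | s ≤ |empiricalFreq (P j) (fun i => C i ω) -
    ν.finExp fun b => if P j b then 1 else 0|} with hB
  -- Covering the whole space needs only monotonicity and subadditivity, so `G` need not be
  -- measurable.
  have hcover : Set.univ ⊆ G ∪ ⋃ j, B j := by
    intro ω _
    by_cases h : ω ∈ ⋃ j, B j
    · exact Or.inr h
    · refine Or.inl (hG ω fun j => ?_)
      by_contra hj
      exact h (Set.mem_iUnion.mpr ⟨j, (not_le.mp hj).le⟩)
  have hbad : μ.real (⋃ j, B j) ≤ Fintype.card J * (2 * Real.exp (-(2 * s ^ 2 * t))) := by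
    refine (measureReal_iUnion_fintype_le B).trans ?_
    rw [← nsmul_eq_mul, ← Finset.card_univ]
    exact Finset.sum_le_card_nsmul _ _ _ fun j _ =>
      measureReal_empiricalFreq_sub_ge_le ht hCm hC hlaw (P j) hs
  have h := (measureReal_mono (μ := μ) hcover).trans (measureReal_union_le _ _)
  rw [probReal_univ] at h
  linarith

end Concentration

/-! ### Accuracy of the learned graph. -/

section Learning

variable {V : Type*} [Fintype V] [DecidableEq V] {t : ℕ}

/-- The events whose frequencies determine the learned graph. -/
def observedEvent : V ⊕ V ⊕ V × V → Cascade V → Prop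
  | .inl u, c => u ∈ c.active 0
  | .inr (.inl v), c => v ∈ c.active 1
  | .inr (.inr (u, v)), c => u ∉ c.active 0 ∧ v ∈ c.active 1

instance (j : V ⊕ V ⊕ V × V) : DecidablePred (observedEvent (V := V) j) :=
  match j with
  | .inl u => fun c => inferInstanceAs (Decidable (u ∈ c.active 0))
  | .inr (.inl v) => fun c => inferInstanceAs (Decidable (v ∈ c.active 1))
  | .inr (.inr (u, v)) => fun c => inferInstanceAs (Decidable (u ∉ c.active 0 ∧ v ∈ c.active 1))

/-- If all observed frequencies are close to their means, then so is the learned graph to the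
true one. -/
theorem abs_learnedGraph_sub_le {p : EdgeProb V} {D : PMF (Finset V)}
    (hD : IsProductSeedDistribution D) {α γ : ℝ} (hassum : EstimationAssumption p D α γ)
    {η s : ℝ} (hη₀ : 0 ≤ η) (hη₁ : η ≤ 1 / 2) (hs : s = η * α * γ / 16) (ht : 0 < t)
    (c : Fin t → Cascade V)
    (hc : ∀ j, |empiricalFreq (observedEvent j) c -
      (cascadeLaw p D).finExp fun b => if observedEvent j b then 1 else 0| ≤ s)
    {u v : V} (huv : u ≠ v) :
    |(p u v : ℝ) - (learnedGraph c u v : ℝ)| ≤ η := by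
  have hV : 1 ≤ Fintype.card V - 1 := by
    have := Fintype.one_lt_card_iff.mpr ⟨u, v, huv⟩
    omega
  have hq : |estSeedProb c u - seedProb D u| ≤ s := by
    rw [← finExp_cascadeLaw_seed p D hV u]
    exact hc (.inl u)
  have ha : |estActivationProb c v - activationProb p D v| ≤ s := by
    rw [activationProb_eq]
    exact hc (.inr (.inl v))
  have key : |estEdgeProb c u v - (p u v : ℝ)| ≤ η := by
    rw [estEdgeProb, estCondActivationProb_eq ht]
    refine abs_edge_formula_sub_le (p u v).2.1 (p u v).2.2 hassum.alpha_mem.1 hassum.alpha_mem.2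
      hassum.gamma_mem.1 (hassum.le_seedProb u) (hassum.seedProb_le u) ENNReal.toReal_nonneg
      (hassum.activationProb_le v) ?_ (edge_identity p hD huv) hη₀ hη₁ hs hq ha
      (hc (.inr (.inr (u, v))))
    refine ((cascadeLaw p D).finExp_const 0).symm.le.trans ?_
    exact PMF.finExp_mono _ fun b => by split_ifs <;> norm_num
  rw [abs_sub_comm]
  refine le_trans ?_ key
  -- Truncation to `[0, 1]` is 1-Lipschitz and fixes `p u v`.
  have h := Set.abs_projIcc_sub_projIcc (zero_le_one (α := ℝ)) (c := estEdgeProb c u v)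
    (d := (p u v : ℝ))
  rw [Set.projIcc_of_mem (zero_le_one (α := ℝ)) (p u v).2] at h
  exact h

end Learning

/-! ### From accurate spreads to approximate maximization. -/

section Maximization

variable {V : Type*} [Fintype V] [DecidableEq V]

/-- An approximation algorithm run on a graph with nearly the true influence spreads. -/
theorem IsApproxAlgorithm.le_influenceSpread {κ : ℝ} {A : EdgeProb V → ℕ → Finset V}
    (hA : IsApproxAlgorithm κ A) (hκ : κ ∈ Set.Ioc (0 : ℝ) 1) {p p' : EdgeProb V} {ε : ℝ}
    (hε : 0 < ε) {k : ℕ} (hk : 1 ≤ k) (hkn : k ≤ Fintype.card V) {S : Finset V}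
    (hS : IsOptimalSeedSet p k S)
    (h : ∀ T, |influenceSpread p T - influenceSpread p' T| ≤ ε * k / 2) :
    (κ - ε) * influenceSpread p S ≤ influenceSpread p (A p' k) := by
  -- Any `k` seeds already have spread at least `k`; this makes the additive error relative.
  have hkS : (k : ℝ) ≤ influenceSpread p S := by
    obtain ⟨T, -, hT⟩ := Finset.exists_subset_card_eq
      (s := (Finset.univ : Finset V)) (n := k) (by rwa [Finset.card_univ])
    exact (hT ▸ card_le_influenceSpread p T).trans (hS.2 T hT.le)
  have h₁ := (hA p' k hk hkn).2 S hS.1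
  have h₂ := (abs_le.mp (h (A p' k))).1
  have h₃ := (abs_le.mp (h S)).2
  have hεk : 0 ≤ ε * k / 2 := by positivity
  have h₄ : κ * (influenceSpread p S - influenceSpread p' S) ≤ 1 * (ε * k / 2) :=
    (mul_le_mul_of_nonneg_left h₃ hκ.1.le).trans (mul_le_mul_of_nonneg_right hκ.2 hεk)
  have h₅ := mul_le_mul_of_nonneg_left hkS hε.le
  linarith

end Maximization

/-- The sample size suffices for the union bound. -/
theorem union_bound_le {n k t ε δ α γ s N : ℝ} (hn : 1 ≤ n) (hk : 0 < k)
    (hε : 0 < ε) (hδ : δ ∈ Set.Ioo (0 : ℝ) 1) (hα : 0 < α) (hγ₀ : 0 < γ) (hγ₁ : γ ≤ 1)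
    (hs : s = ε * k / (2 * n ^ 3) * α * γ / 16) (hN : N ≤ 3 * n ^ 2)
    (ht : 1024 / (ε ^ 2 * α ^ 2 * γ ^ 3) * (n ^ 6 / k ^ 2) * Real.log (12 * n / δ) ≤ t) :
    N * (2 * Real.exp (-(2 * s ^ 2 * t))) ≤ δ := by
  have hn₀ : 0 < n := by linarith
  have hδ₀ := hδ.1
  have hx : 0 < 12 * n / δ := by positivity
  have hlog : 0 ≤ Real.log (12 * n / δ) := by
    refine Real.log_nonneg ?_
    rw [le_div_iff₀ hδ₀]
    linarith [hδ.2]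
  -- The constant `1024 = 32²` cancels that of `s = εkαγ/(32n³)`; a factor `1/γ ≥ 1` is left over
  -- and dropped.
  have hst : Real.log (12 * n / δ) ≤ s ^ 2 * t := by
    have h := mul_le_mul_of_nonneg_left ht (sq_nonneg s)
    have heq : s ^ 2 * (1024 / (ε ^ 2 * α ^ 2 * γ ^ 3) * (n ^ 6 / k ^ 2) *
        Real.log (12 * n / δ)) = Real.log (12 * n / δ) / γ := by
      rw [hs]
      field_simp
      norm_num
    rw [heq] at h
    exact (le_div_self hlog hγ₀ hγ₁).trans h
  have hexp : Real.exp (-(2 * s ^ 2 * t)) ≤ (δ / (12 * n)) ^ 2 := by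
    calc Real.exp (-(2 * s ^ 2 * t)) ≤ Real.exp (-(2 * Real.log (12 * n / δ))) :=
          Real.exp_le_exp.mpr (by linarith)
      _ = (δ / (12 * n)) ^ 2 := by
          rw [Real.exp_neg, two_mul, Real.exp_add, Real.exp_log hx, ← sq, ← inv_pow, inv_div]
  calc N * (2 * Real.exp (-(2 * s ^ 2 * t)))
      ≤ 3 * n ^ 2 * (2 * (δ / (12 * n)) ^ 2) :=
        mul_le_mul hN (mul_le_mul_of_nonneg_left hexp zero_le_two) (by positivity) (by positivity)
    _ = δ * δ / 24 := by
        field_simp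
        norm_num
    _ ≤ δ := by nlinarith [hδ.1, hδ.2]

end

theorem mainTheorem4 {V : Type*} [Fintype V] [DecidableEq V]
    (p : EdgeProb V) (D : PMF (Finset V)) (hD : IsProductSeedDistribution D)
    (α γ : ℝ) (hassum : EstimationAssumption p D α γ)
    (ε δ : ℝ) (hε : ε ∈ Set.Ioo (0 : ℝ) 1) (hδ : δ ∈ Set.Ioo (0 : ℝ) 1)
    (k : ℕ) (hk : 1 ≤ k) (hkn : k ≤ Fintype.card V)
    (t : ℕ)
    (ht : 1024 / (ε ^ 2 * α ^ 2 * γ ^ 3) * ((Fintype.card V : ℝ) ^ 6 / (k : ℝ) ^ 2) *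
      Real.log (12 * (Fintype.card V : ℝ) / δ) ≤ (t : ℝ))
    {Ω : Type*} [MeasurableSpace Ω] (μ : Measure Ω) [IsProbabilityMeasure μ]
    (C : Fin t → Ω → Cascade V) (hCm : ∀ i, Measurable (C i))
    (hCindep : iIndepFun C μ)
    (hClaw : ∀ i, μ.map (C i) = (cascadeLaw p D).toMeasure)
    (κ : ℝ) (hκ : κ ∈ Set.Ioc (0 : ℝ) 1)
    (A : EdgeProb V → ℕ → Finset V) (hA : IsApproxAlgorithm κ A)
    (Sstar : Finset V) (hSstar : IsOptimalSeedSet p k Sstar) :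
    1 - δ ≤ μ.real {ω | (κ - ε) * influenceSpread p Sstar ≤
      influenceSpread p (imsAlgorithm A (fun i => C i ω) k)} := by
  have hn : (1 : ℝ) ≤ Fintype.card V := by exact_mod_cast hk.trans hkn
  have hn₀ : (0 : ℝ) < Fintype.card V := by linarith
  have hk₁ : (1 : ℝ) ≤ k := by exact_mod_cast hk
  have hk₀ : (0 : ℝ) < k := by linarith
  have hkn' : (k : ℝ) ≤ Fintype.card V := by exact_mod_cast hkn
  obtain ⟨hε₀, hε₁⟩ := hε
  have hα := hassum.alpha_mem.1
  have hγ := hassum.gamma_mem.1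
  have hδ₀ := hδ.1
  set n : ℝ := (Fintype.card V : ℝ) with hn_def
  -- Chosen so that `n³η = εk/2`.
  set η : ℝ := ε * k / (2 * n ^ 3) with hη
  have hη₀ : 0 ≤ η := by positivity
  have hη₁ : η ≤ 1 / 2 := by
    rw [hη, div_le_div_iff₀ (by positivity) two_pos]
    have h₁ : ε * k ≤ n := by nlinarith
    have h₂ : n ≤ n ^ 3 := le_self_pow₀ hn (by norm_num)
    linarith
  have ht₀ : 0 < t := by
    have hlog : 0 < Real.log (12 * n / δ) := by
      refine Real.log_pos ?_
      rw [lt_div_iff₀ hδ₀]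
      linarith [hδ.2]
    have : (0 : ℝ) < t := lt_of_lt_of_le (by positivity) ht
    exact_mod_cast this
  have hbound := one_sub_le_measureReal_of_empiricalFreq ht₀ hCm hCindep hClaw
    (observedEvent (V := V)) (s := η * α * γ / 16) (by positivity)
    (G := {ω | (κ - ε) * influenceSpread p Sstar ≤
      influenceSpread p (imsAlgorithm A (fun i => C i ω) k)}) (by
    intro ω hω
    refine hA.le_influenceSpread hκ hε₀ hk hkn hSstar fun T => ?_
    refine (abs_influenceSpread_sub_le hη₀ (fun u v huv =>
      abs_learnedGraph_sub_le hD hassum hη₀ hη₁ rfl ht₀ _ hω huv) T).trans (le_of_eq ?_)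
    rw [hη, ← hn_def]
    field_simp)
  -- There are `2n + n²` events, and `n ≤ n²`.
  have hcard : (Fintype.card (V ⊕ V ⊕ V × V) : ℝ) ≤ 3 * n ^ 2 := by
    rw [Fintype.card_sum, Fintype.card_sum, Fintype.card_prod]
    push_cast
    nlinarith
  have := union_bound_le hn hk₀ hε₀ hδ hα hγ (by linarith [hassum.gamma_mem.2]) rfl hcard ht
  linarith
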